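/- Let $K$ be a quadratic number field, and embed $K[x]$ in the field $L=K((1/x))$ of formal Laurent series in $1/x$. For $\alpha\in L$ the continued fraction expansion $\alpha=[a_0,a_1,a_2,\ldots]$ is given by $\alpha_0=\alpha$, $a_h=$ the polynomial part of $\alpha_h$, and $\alpha_{h+1}=(\alpha_h-a_h)^{-1}$ as long as $\alpha_h\neq a_h$. An infinite expansion is periodic with period $n$ if $n$ is the smallest positive integer such that $a_{h+n}=a_h$ for every $h>1$. Let $f(x)=(x^2+u)^2-4v(x+w)\in K[x]$, where either (i) for some $t\in K$ with $t(t+1)(3t^2+6t-1)\neq 0$ and $t\neq \tfrac14$, $$u=\frac{3t^2+6t-1}{4},\qquad v=t(t+1),\qquad w=\frac{t-1}{2};$$ or (ii) for some $t,s\in K$ with $s^2-s=t^3-t^2$ (that is, a $K$-rational point $(t,s)$ of $X_1(11)$) and $t(t-1)(t^5-18t^4+35t^3-16t^2-2t+1)\neq 0$, $$u=-\frac{s^4+2s^3t+t^2+6st^2-3s^2t(2+t)}{4t^2},\qquad v=-\frac{(s-1)s(s-t)}{t},\qquad w=\frac{s^2-t-st}{2t}.$$ Then $f$ has a square root in $K((1/x))$,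 and the continued fraction expansion of $\sqrt{f(x)}$ (for either choice of the sign of the root) is infinite and periodic with period $10$. -/

import Mathlib

open Polynomial

noncomputable section

namespace FunctionFieldCF

variable {K : Type*} [Field K]

/-- The field `K((1/x))` of Laurent series at infinity is modelled by `LaurentSeries K`, whose
uniformizer is `1/x`: the coefficient of index `m` is the coefficient of `x ^ (-m)`.
This is the embedding `K[x] → K((1/x))`. -/
def ofPoly : K[X] →+* LaurentSeries K :=
  (Polynomial.aeval (R := K) (HahnSeries.single (-1 : ℤ) (1 : K) : LaurentSeries K)).toRingHom

/-- The polynomial part of a Laurent series `∑ c_m x ^ (-m)`, namely `∑_{n ≥ 0} c_{-n} x ^ n`. -/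
def polyPart (α : LaurentSeries K) : K[X] :=
  ∑ n ∈ Finset.range ((-α.order).toNat + 1), Polynomial.monomial n (α.coeff (-(n : ℤ)))

/-- The complete quotients: `α₀ = α` and `α_{h+1} = (α_h - a_h)⁻¹`, where `a_h` is the polynomial
part of `α_h`. -/
def completeQuotient (α : LaurentSeries K) : ℕ → LaurentSeries K
  | 0 => α
  | h + 1 => (completeQuotient α h - ofPoly (polyPart (completeQuotient α h)))⁻¹

/-- The partial quotients `a_h` of `α = [a₀, a₁, a₂, …]`. -/
def partialQuotient (α : LaurentSeries K) (h : ℕ) : K[X] :=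
  polyPart (completeQuotient α h)

/-- The continued fraction of `α` is infinite and periodic with period `n`: `n` is the smallest
positive integer such that `a_{h+n} = a_h` for every `h > 1`. -/
def HasCFPeriod (α : LaurentSeries K) (n : ℕ) : Prop :=
  (∀ h, completeQuotient α h ≠ ofPoly (partialQuotient α h)) ∧
  IsLeast {m : ℕ | 0 < m ∧ ∀ h, 1 < h → partialQuotient α (h + m) = partialQuotient α h} n

/-- `f` has a square root in `K((1/x))`, and the continued fraction of each of its (two) square
roots `±√f` is periodic with period `n`. -/
def SqrtHasCFPeriod (f : K[X]) (n : ℕ) : Prop :=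
  (∃ y : LaurentSeries K, y ^ 2 = ofPoly f) ∧
  ∀ y : LaurentSeries K, y ^ 2 = ofPoly f → HasCFPeriod y n

/-- The quartic polynomial `(x² + u)² - 4 v (x + w)`. -/
def quartic (u v w : K) : K[X] :=
  (X ^ 2 + C u) ^ 2 - C (4 * v) * (X + C w)

end FunctionFieldCF

end

open Polynomial

namespace FunctionFieldCF

variable {K : Type*} [Field K]

/-! Put A = x² + u and let y be the root of f with polynomial part A. Each complete quotient of y
has the form (y + P)/Q with Q dividing f - P², as in Lagrange's theorem for quadratic irrationals.
Here every P met after the start is A + 2e with e constant, and Q is c(x + d) or a constant.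
Dividing out becomes a few scalar identities in e, d, c (`completeQuotient_succ_linear`), so each
family needs only an explicit table of constants. In both families α₁₁ = α₁, which gives period 10.
It is minimal because a₁₀ = 2A is quadratic while the other aₘ with 0 < m < 10 are linear, except
that in family (i) a₅ = 2A/(4t), which differs from 2A because 4t ≠ 1. -/

theorem ofPoly_monomial (n : ℕ) (a : K) :
    ofPoly (monomial n a) = HahnSeries.single (-(n : ℤ)) a := by
  simp [ofPoly, aeval_monomial, LaurentSeries.algebraMap_apply, HahnSeries.single_pow]

theorem coeff_ofPoly (p : K[X]) (m : ℤ) :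
    (ofPoly p).coeff m = if m ≤ 0 then p.coeff (-m).toNat else 0 := by
  induction p using Polynomial.induction_on' with
  | add p q hp hq => rw [map_add, HahnSeries.coeff_add, hp, hq]; split_ifs <;> simp
  | monomial n a =>
    rw [ofPoly_monomial, HahnSeries.coeff_single, coeff_monomial]
    split_ifs <;> first | rfl | omega

theorem coeff_ofPoly_neg_natCast (p : K[X]) (n : ℕ) : (ofPoly p).coeff (-(n : ℤ)) = p.coeff n := by
  simp [coeff_ofPoly]

theorem orderTop_ofPoly {p : K[X]} (hp : p ≠ 0) :
    (ofPoly p).orderTop = ((-(p.natDegree : ℤ) : ℤ) : WithTop ℤ) := by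
  refine HahnSeries.orderTop_eq_of_le ?_ fun m hm ↦ ?_
  · rw [HahnSeries.mem_support, coeff_ofPoly_neg_natCast]
    exact leadingCoeff_ne_zero.mpr hp
  · rw [HahnSeries.mem_support, coeff_ofPoly] at hm
    split_ifs at hm with h
    · have := le_natDegree_of_ne_zero hm
      omega
    · exact absurd rfl hm

theorem ofPoly_injective : Function.Injective (ofPoly : K[X] → LaurentSeries K) := by
  intro p q h
  ext n
  rw [← coeff_ofPoly_neg_natCast, h, coeff_ofPoly_neg_natCast]

theorem coeff_polyPart (α : LaurentSeries K) (n : ℕ) :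
    (polyPart α).coeff n = α.coeff (-(n : ℤ)) := by
  simp only [polyPart, finsetSum_coeff, coeff_monomial, Finset.sum_ite_eq', Finset.mem_range]
  split_ifs with h
  · rfl
  · exact (HahnSeries.coeff_eq_zero_of_lt_order (by omega)).symm

/-- The polynomial part is characterised by the remainder having positive order. -/
theorem polyPart_eq_of_orderTop_pos {α : LaurentSeries K} {p : K[X]}
    (h : 0 < (α - ofPoly p).orderTop) : polyPart α = p := by
  ext n
  have := HahnSeries.coeff_eq_zero_of_lt_orderTop (x := α - ofPoly p) (i := -(n : ℤ))
    (lt_of_le_of_lt (by exact_mod_cast (by omega : -(n : ℤ) ≤ 0)) h)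
  rw [HahnSeries.coeff_sub, coeff_ofPoly_neg_natCast, sub_eq_zero] at this
  rw [coeff_polyPart, this]

theorem polyPart_zero : polyPart (0 : LaurentSeries K) = 0 := by
  ext n; simp [coeff_polyPart]

theorem polyPart_neg (α : LaurentSeries K) : polyPart (-α) = -polyPart α := by
  ext n; simp [coeff_polyPart]

theorem completeQuotient_neg (α : LaurentSeries K) (h : ℕ) :
    completeQuotient (-α) h = -completeQuotient α h := by
  induction h with
  | zero => rfl
  | succ h ih =>
    rw [completeQuotient, completeQuotient, ih, polyPart_neg, map_neg, ← inv_neg]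
    congr 1; ring

theorem HasCFPeriod.neg {α : LaurentSeries K} {n : ℕ} (h : HasCFPeriod α n) :
    HasCFPeriod (-α) n := by
  have hp (k : ℕ) : partialQuotient (-α) k = -partialQuotient α k := by
    rw [partialQuotient, completeQuotient_neg, polyPart_neg, partialQuotient]
  simpa only [HasCFPeriod, hp, completeQuotient_neg, map_neg, neg_inj, ne_eq] using h

/-! ### A criterion for the exact period. -/

theorem completeQuotient_eq_zero_add {α : LaurentSeries K} {h : ℕ}
    (h0 : completeQuotient α h = 0) (k : ℕ) : completeQuotient α (h + k) = 0 := by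
  induction k with
  | zero => exact h0
  | succ k ih => rw [← add_assoc, completeQuotient, ih, polyPart_zero]; simp

/-- If the complete quotients of index `1` and `n + 1` agree and the partial quotient of index `n`
differs from the previous ones, the continued fraction has period exactly `n`. -/
theorem hasCFPeriod_of_completeQuotient_eq {α : LaurentSeries K} {n : ℕ} (hn : 1 < n)
    (hper : completeQuotient α (n + 1) = completeQuotient α 1)
    (hne0 : completeQuotient α n ≠ 0)
    (hne : ∀ m, 0 < m → m < n → partialQuotient α m ≠ partialQuotient α n) :
    HasCFPeriod α n := by
  have hcq (h : ℕ) : completeQuotient α (h + 1 + n) = completeQuotient α (h + 1) := by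
    induction h with
    | zero => rw [← hper]; congr 1; omega
    | succ h ih =>
      rw [show h + 1 + 1 + n = (h + 1 + n) + 1 by omega, completeQuotient, ih]
      rfl
  have hpq (h : ℕ) (hh : 0 < h) : partialQuotient α (h + n) = partialQuotient α h := by
    obtain ⟨k, rfl⟩ := Nat.exists_eq_add_of_lt hh
    rw [zero_add, partialQuotient, hcq, partialQuotient]
  have hmul (k : ℕ) : completeQuotient α (n + k * n) = completeQuotient α n := by
    induction k with
    | zero => simp
    | succ k ih =>
      rw [show n + (k + 1) * n = (n - 1 + k * n) + 1 + n by
        rw [add_mul, one_mul]; omega, hcq, ← ih]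
      congr 1; omega
  refine ⟨fun h heq ↦ hne0 ?_, ⟨by omega, fun h hh ↦ hpq h (by omega)⟩, fun m hm ↦ ?_⟩
  -- As 0⁻¹ = 0, a terminating expansion has only zero quotients afterwards, whereas the nonzero αₙ
  -- recurs at arbitrarily large indices.
  · have h0 : completeQuotient α (h + 1) = 0 := by
      rw [completeQuotient, ← partialQuotient, ← heq, sub_self, inv_zero]
    rw [← hmul (h + 1)]
    have hle : h + 1 ≤ n + (h + 1) * n := by nlinarith
    obtain ⟨k, hk⟩ := Nat.exists_eq_add_of_le hle
    rw [hk]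
    exact completeQuotient_eq_zero_add h0 k
  · by_contra! hlt
    refine hne m hm.1 hlt ?_
    -- A smaller period m gives aₙ = aₙ₊ₘ = aₘ.
    rw [← hm.2 n hn, add_comm, hpq m hm.1]

/-! ### Square roots in K((1/x)). -/

/-- A Laurent series `1 + ε` with `ε` of positive order has a square root `1 + δ` with `δ` of
positive order. -/
theorem exists_sq_eq_of_orderTop_pos [CharZero K] {z : LaurentSeries K}
    (hz : 0 < (z - 1).orderTop) : ∃ S : LaurentSeries K, S ^ 2 = z ∧ 0 < (S - 1).orderTop := by
  let _ : Algebra ℚ K := DivisionRing.toRatAlgebra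
  -- The series (1 + X)^(1/2) evaluated at X = z - 1; exponents add, so its square is 1 + X.
  refine ⟨PowerSeries.heval (z - 1) (PowerSeries.binomialSeries K (1 / 2 : ℚ)), ?_,
    HahnSeries.SummableFamily.orderTop_hsum_binomialFamily_pos hz (1 / 2 : ℚ)⟩
  rw [sq, ← map_mul, ← PowerSeries.binomialSeries_add,
    show (1 / 2 + 1 / 2 : ℚ) = ((1 : ℕ) : ℚ) by norm_num, PowerSeries.binomialSeries_nat, pow_one,
    map_add, map_one, PowerSeries.heval_X _ hz]
  ring

/-- With R = 4v(x + w), take y = A·S where S² = 1 - R/A². Then y - A = -R/(A(S + 1)) has order at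
least -1 + 2 = 1. -/
theorem exists_sq_eq_ofPoly_quartic [CharZero K] (u v w : K) :
    ∃ y : LaurentSeries K, y ^ 2 = ofPoly (quartic u v w) ∧
      0 < (y - ofPoly (X ^ 2 + C u)).orderTop := by
  set A : K[X] := X ^ 2 + C u with hA
  set R : K[X] := C (4 * v) * (X + C w) with hR
  have hf : quartic u v w = A ^ 2 - R := rfl
  have hAdeg : A.natDegree = 2 := natDegree_X_pow_add_C
  have hA0 : A ≠ 0 := fun h ↦ by simp [h] at hAdeg
  have hA0' : ofPoly A ≠ 0 := (map_ne_zero_iff _ ofPoly_injective).mpr hA0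
  have hRord : (((-1 : ℤ)) : WithTop ℤ) ≤ (ofPoly R).orderTop := by
    rcases eq_or_ne R 0 with h | h
    · simp [h]
    · rw [orderTop_ofPoly h, WithTop.coe_le_coe]
      have : R.natDegree ≤ 1 := by rw [hR]; compute_degree
      omega
  have hAord : (ofPoly A).orderTop = ((-2 : ℤ) : WithTop ℤ) := by
    rw [orderTop_ofPoly hA0, hAdeg]; rfl
  have hquot {b z : LaurentSeries K} (hz : b.orderTop = ((-2 : ℤ) : WithTop ℤ)) (n : ℤ)
      (h : ((n - 2 : ℤ) : WithTop ℤ) ≤ (z * b).orderTop) : (n : WithTop ℤ) ≤ z.orderTop := by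
    rw [HahnSeries.orderTop_mul, hz] at h
    cases hk : z.orderTop with
    | top => exact le_top
    | coe k =>
      rw [hk, ← WithTop.coe_add, WithTop.coe_le_coe] at h
      rw [WithTop.coe_le_coe]
      omega
  have hε : 0 < ((1 - ofPoly R / ofPoly A ^ 2) - 1).orderTop := by
    rw [show (1 - ofPoly R / ofPoly A ^ 2) - 1 = -(ofPoly R / ofPoly A ^ 2) by ring,
      HahnSeries.orderTop_neg]
    refine lt_of_lt_of_le (b := ((3 : ℤ) : WithTop ℤ)) (by exact_mod_cast (by norm_num : (0:ℤ) < 3))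
      (hquot hAord 3 (hquot hAord (3 - 2) ?_))
    rwa [show ofPoly R / ofPoly A ^ 2 * ofPoly A * ofPoly A = ofPoly R by field_simp]
  obtain ⟨S, hS, hS1⟩ := exists_sq_eq_of_orderTop_pos hε
  have hsq : (ofPoly A * S) ^ 2 = ofPoly A ^ 2 - ofPoly R := by
    rw [mul_pow, hS]; field_simp
  refine ⟨ofPoly A * S, by rw [hsq, hf, map_sub, map_pow], ?_⟩
  have hS2 : (S + 1).orderTop = 0 := by
    have h2 : (HahnSeries.C (2 : K) : LaurentSeries K).orderTop = 0 :=
      HahnSeries.orderTop_single two_ne_zero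
    rw [show S + 1 = HahnSeries.C (2 : K) + (S - 1) by rw [map_ofNat]; ring,
      HahnSeries.orderTop_add_eq_left (by rwa [h2]), h2]
  have hb : (ofPoly A * (S + 1)).orderTop = ((-2 : ℤ) : WithTop ℤ) := by
    rw [HahnSeries.orderTop_mul, hS2, hAord, add_zero]
  refine lt_of_lt_of_le (b := ((1 : ℤ) : WithTop ℤ)) (by exact_mod_cast one_pos) (hquot hb 1 ?_)
  rw [show (ofPoly A * S - ofPoly A) * (ofPoly A * (S + 1)) = -ofPoly R by linear_combination hsq,
    HahnSeries.orderTop_neg]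
  exact hRord

/-! ### Single steps of the algorithm on (y + P)/Q. -/

section Steps

variable {y : LaurentSeries K} {h : ℕ}

/-- One step of the continued fraction algorithm on `(y + P) / Q`, where `y` is a square root of `f`
with polynomial part `A`. -/
theorem completeQuotient_succ_of_eq_div {f A P Q a P' Q' : K[X]} (hy : y ^ 2 = ofPoly f)
    (hA : 0 < (y - ofPoly A).orderTop) (hQ : Q ≠ 0) (hQ' : Q' ≠ 0) (hP : P + P' = a * Q)
    (hf : f - P' ^ 2 = Q * Q') (hdeg : (P' - A).degree < Q.degree)
    (hc : completeQuotient y h = (y + ofPoly P) / ofPoly Q) :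
    partialQuotient y h = a ∧ completeQuotient y (h + 1) = (y + ofPoly P') / ofPoly Q' := by
  have hQ0 : ofPoly Q ≠ 0 := (map_ne_zero_iff _ ofPoly_injective).mpr hQ
  have hQ0' : ofPoly Q' ≠ 0 := (map_ne_zero_iff _ ofPoly_injective).mpr hQ'
  have hsub : completeQuotient y h - ofPoly a = (y - ofPoly P') / ofPoly Q := by
    have := congrArg ofPoly hP
    rw [map_add, map_mul] at this
    rw [hc]
    field_simp
    linear_combination this
  have hmul : (y - ofPoly P') * (y + ofPoly P') = ofPoly Q * ofPoly Q' := by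
    have := congrArg ofPoly hf
    rw [map_sub, map_pow, map_mul, ← hy] at this
    linear_combination this
  have ha : partialQuotient y h = a := by
    refine polyPart_eq_of_orderTop_pos ?_
    rw [hsub]
    by_contra! hle
    -- Both y - A and P' - A have degree below that of Q, so (y - P')/Q has no polynomial part.
    have hlt : (ofPoly Q).orderTop < ((y - ofPoly P') / ofPoly Q * ofPoly Q).orderTop := by
      rw [div_mul_cancel₀ _ hQ0,
        show y - ofPoly P' = (y - ofPoly A) - ofPoly (P' - A) by rw [map_sub]; ring]
      refine lt_of_lt_of_le (lt_min ?_ ?_) HahnSeries.min_orderTop_le_orderTop_sub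
      · refine lt_of_le_of_lt ?_ hA
        rw [orderTop_ofPoly hQ]
        exact_mod_cast (by omega : -(Q.natDegree : ℤ) ≤ 0)
      · rcases eq_or_ne (P' - A) 0 with h0 | h0
        · rw [h0, map_zero, HahnSeries.orderTop_zero, orderTop_ofPoly hQ]
          exact WithTop.coe_lt_top _
        · rw [orderTop_ofPoly hQ, orderTop_ofPoly h0, WithTop.coe_lt_coe]
          have := natDegree_lt_natDegree h0 hdeg
          omega
    rw [HahnSeries.orderTop_mul] at hlt
    refine absurd hlt (not_lt.mpr ?_)
    simpa using add_le_add_left hle (ofPoly Q).orderTop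
  refine ⟨ha, ?_⟩
  have hne : y - ofPoly P' ≠ 0 := fun h0 ↦ by
    rw [h0, zero_mul] at hmul
    exact mul_ne_zero hQ0 hQ0' hmul.symm
  rw [completeQuotient, ← partialQuotient, ha, hsub, inv_div, div_eq_div_iff hne hQ0']
  linear_combination -hmul

variable {u v w : K}

theorem C_mul_X_add_C_ne_zero {c : K} (hc : c ≠ 0) (d : K) : C c * (X + C d) ≠ 0 :=
  mul_ne_zero (C_ne_zero.mpr hc) (X_add_C_ne_zero d)

/-- The term `C (2 * 0)` presents α₁ as the case e = 0 of the linear step. -/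
theorem completeQuotient_one (hv : 4 * v ≠ 0) (hy : y ^ 2 = ofPoly (quartic u v w))
    (hA : 0 < (y - ofPoly (X ^ 2 + C u)).orderTop) :
    completeQuotient y 1 =
      (y + ofPoly (X ^ 2 + C u + C (2 * 0))) / ofPoly (C (-(4 * v)) * (X + C w)) := by
  refine (completeQuotient_succ_of_eq_div (P := 0) (Q := 1) (a := X ^ 2 + C u) hy hA one_ne_zero
    (C_mul_X_add_C_ne_zero (neg_ne_zero.mpr hv) w) ?_ ?_ ?_ ?_).2
  · simp
  · simp only [quartic, mul_zero, map_zero, map_neg]; ring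
  · simp
  · simp [completeQuotient]

/-- For P' = A + 2e', f - P'² = -4(e'x² + vx + e'(u + e') + vw). Vieta's formulas for the roots -d,
-d' are `h3` and `h4`, and `h2` matches leading coefficients; `h1` says that Q divides P + P'. -/
theorem completeQuotient_succ_linear (hy : y ^ 2 = ofPoly (quartic u v w))
    (hA : 0 < (y - ofPoly (X ^ 2 + C u)).orderTop) {c d e c' d' e' : K} (hc : c ≠ 0) (hc' : c' ≠ 0)
    (h1 : e + e' + d ^ 2 + u = 0) (h2 : c * c' = -(4 * e')) (h3 : e' * (d + d') = v)
    (h4 : e' * (d * d') = e' * (u + e') + v * w)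
    (hq : completeQuotient y h =
      (y + ofPoly (X ^ 2 + C u + C (2 * e))) / ofPoly (C c * (X + C d))) :
    partialQuotient y h = C (2 / c) * (X - C d) ∧ completeQuotient y (h + 1) =
      (y + ofPoly (X ^ 2 + C u + C (2 * e'))) / ofPoly (C c' * (X + C d')) := by
  refine completeQuotient_succ_of_eq_div hy hA (C_mul_X_add_C_ne_zero hc d)
    (C_mul_X_add_C_ne_zero hc' d') ?_ ?_ ?_ hq
  · have hcc : (C (2 / c) * C c : K[X]) = 2 := by rw [← C_mul, div_mul_cancel₀ _ hc, map_ofNat]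
    have h1' := congrArg (C : K → K[X]) h1
    simp only [map_add, map_pow, map_zero, map_mul, map_ofNat] at h1' ⊢
    linear_combination (-(X - C d) * (X + C d)) * hcc + 2 * h1'
  · have h2' := congrArg (C : K → K[X]) h2
    have h3' := congrArg (C : K → K[X]) h3
    have h4' := congrArg (C : K → K[X]) h4
    simp only [quartic, map_add, map_mul, map_ofNat, map_neg] at h2' h3' h4' ⊢
    linear_combination (-(X + C d) * (X + C d')) * h2' + 4 * X * h3' + 4 * h4'
  · rw [degree_C_mul hc, degree_X_add_C, add_sub_cancel_left]
    exact degree_C_le.trans_lt (by norm_num)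

/-- The case e' = 0: f - A² = -4v(x + w) is only linear, so the next denominator is constant. -/
theorem completeQuotient_succ_of_dvd (hy : y ^ 2 = ofPoly (quartic u v w))
    (hA : 0 < (y - ofPoly (X ^ 2 + C u)).orderTop) {c e k : K} (hc : c ≠ 0) (hk : k ≠ 0)
    (h1 : e + w ^ 2 + u = 0) (h2 : c * k = -(4 * v))
    (hq : completeQuotient y h =
      (y + ofPoly (X ^ 2 + C u + C (2 * e))) / ofPoly (C c * (X + C w))) :
    partialQuotient y h = C (2 / c) * (X - C w) ∧ completeQuotient y (h + 1) =
      (y + ofPoly (X ^ 2 + C u)) / ofPoly (C k) := by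
  refine completeQuotient_succ_of_eq_div hy hA (C_mul_X_add_C_ne_zero hc w)
    (C_ne_zero.mpr hk) ?_ ?_ ?_ hq
  · have hcc : (C (2 / c) * C c : K[X]) = 2 := by rw [← C_mul, div_mul_cancel₀ _ hc, map_ofNat]
    have h1' := congrArg (C : K → K[X]) h1
    simp only [map_add, map_pow, map_zero, map_mul, map_ofNat] at h1' ⊢
    linear_combination (-(X - C w) * (X + C w)) * hcc + 2 * h1'
  · have h2' := congrArg (C : K → K[X]) h2
    simp only [quartic, map_mul, map_ofNat, map_neg] at h2' ⊢
    linear_combination (-(X + C w)) * h2'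
  · rw [sub_self, degree_zero]
    exact bot_lt_iff_ne_bot.mpr (degree_ne_bot.mpr (C_mul_X_add_C_ne_zero hc w))

theorem completeQuotient_succ_const (hy : y ^ 2 = ofPoly (quartic u v w))
    (hA : 0 < (y - ofPoly (X ^ 2 + C u)).orderTop) {c k : K} (hc : c ≠ 0) (hk : k ≠ 0)
    (h2 : k * c = -(4 * v))
    (hq : completeQuotient y h = (y + ofPoly (X ^ 2 + C u)) / ofPoly (C k)) :
    partialQuotient y h = C (2 / k) * (X ^ 2 + C u) ∧ completeQuotient y (h + 1) =
      (y + ofPoly (X ^ 2 + C u + C (2 * 0))) / ofPoly (C c * (X + C w)) := by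
  refine completeQuotient_succ_of_eq_div hy hA (C_ne_zero.mpr hk)
    (C_mul_X_add_C_ne_zero hc w) ?_ ?_ ?_ hq
  · have hkk : (C (2 / k) * C k : K[X]) = 2 := by rw [← C_mul, div_mul_cancel₀ _ hk, map_ofNat]
    simp only [mul_zero, map_zero]
    linear_combination (-(X ^ 2 + C u)) * hkk
  · have h2' := congrArg (C : K → K[X]) h2
    simp only [quartic, map_mul, map_ofNat, map_neg, mul_zero, map_zero] at h2' ⊢
    linear_combination (-(X + C w)) * h2'
  · simp [degree_C hk]

theorem C_mul_linear_ne_C_mul_quadratic {k : K} (hk : k ≠ 0) (a b u : K) :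
    C a * (X - C b) ≠ C k * (X ^ 2 + C u) := by
  intro h
  have := congrArg (fun p ↦ p.coeff 2) h
  simp [coeff_X, coeff_X_pow] at this
  exact hk this.symm

end Steps

/-! ### The two families. -/

theorem sqrtHasCFPeriod_of_forall [CharZero K] {u v w : K} {n : ℕ}
    (H : ∀ y : LaurentSeries K, y ^ 2 = ofPoly (quartic u v w) →
      0 < (y - ofPoly (X ^ 2 + C u)).orderTop → HasCFPeriod y n) :
    SqrtHasCFPeriod (quartic u v w) n := by
  obtain ⟨y, hy, hA⟩ := exists_sq_eq_ofPoly_quartic u v w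
  refine ⟨⟨y, hy⟩, fun z hz ↦ ?_⟩
  rcases sq_eq_sq_iff_eq_or_eq_neg.mp (hz.trans hy.symm) with rfl | rfl
  · exact H _ hy hA
  · exact (H _ hy hA).neg

/-- A continued fraction with palindromic data, as it arises from a point of order `11`. -/
theorem hasCFPeriod_ten_of_palindrome [CharZero K] {u v w : K} {y : LaurentSeries K}
    (hy : y ^ 2 = ofPoly (quartic u v w)) (hA : 0 < (y - ofPoly (X ^ 2 + C u)).orderTop)
    (hv : v ≠ 0) {e₂ e₃ e₄ e₅ w₂ w₃ w₄ w₅ c₂ c₃ c₄ c₅ : K}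
    (hc₂ : c₂ ≠ 0) (hc₃ : c₃ ≠ 0) (hc₄ : c₄ ≠ 0) (hc₅ : c₅ ≠ 0)
    (n₁ : e₂ + w ^ 2 + u = 0) (n₂ : e₂ + e₃ + w₂ ^ 2 + u = 0) (n₃ : e₃ + e₄ + w₃ ^ 2 + u = 0)
    (n₄ : e₄ + e₅ + w₄ ^ 2 + u = 0) (n₅ : e₅ + e₅ + w₅ ^ 2 + u = 0)
    (m₂ : -(4 * v) * c₂ = -(4 * e₂)) (m₃ : c₂ * c₃ = -(4 * e₃)) (m₄ : c₃ * c₄ = -(4 * e₄))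
    (m₅ : c₄ * c₅ = -(4 * e₅))
    (t₂ : e₂ * (w + w₂) = v) (t₃ : e₃ * (w₂ + w₃) = v) (t₄ : e₄ * (w₃ + w₄) = v)
    (t₅ : e₅ * (w₄ + w₅) = v)
    (p₂ : e₂ * (w * w₂) = e₂ * (u + e₂) + v * w) (p₃ : e₃ * (w₂ * w₃) = e₃ * (u + e₃) + v * w)
    (p₄ : e₄ * (w₃ * w₄) = e₄ * (u + e₄) + v * w) (p₅ : e₅ * (w₄ * w₅) = e₅ * (u + e₅) + v * w) :
    HasCFPeriod y 10 := by
  have hc₁ : -(4 * v) ≠ 0 := neg_ne_zero.mpr (mul_ne_zero (by norm_num) hv)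
  have q₁ := completeQuotient_one (neg_ne_zero.mp hc₁) hy hA
  obtain ⟨a₁, q₂⟩ := completeQuotient_succ_linear hy hA hc₁ hc₂ (by linear_combination n₁)
    m₂ t₂ p₂ q₁
  obtain ⟨a₂, q₃⟩ := completeQuotient_succ_linear hy hA hc₂ hc₃ n₂ m₃ t₃ p₃ q₂
  obtain ⟨a₃, q₄⟩ := completeQuotient_succ_linear hy hA hc₃ hc₄ n₃ m₄ t₄ p₄ q₃
  obtain ⟨a₄, q₅⟩ := completeQuotient_succ_linear hy hA hc₄ hc₅ n₄ m₅ t₅ p₅ q₄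
  -- From here the table is read backwards: the relations m, t, p are symmetric under reversal, and
  -- e₅ repeats at the centre.
  obtain ⟨a₅, q₆⟩ := completeQuotient_succ_linear (d' := w₄) (e' := e₅) hy hA hc₅
    hc₄ n₅
    (by linear_combination m₅) (by linear_combination t₅) (by linear_combination p₅) q₅
  obtain ⟨a₆, q₇⟩ := completeQuotient_succ_linear (d' := w₃) (e' := e₄) hy hA hc₄
    hc₃ (by linear_combination n₄)
    (by linear_combination m₄) (by linear_combination t₄) (by linear_combination p₄) q₆
  obtain ⟨a₇, q₈⟩ := completeQuotient_succ_linear (d' := w₂) (e' := e₃) hy hA hc₃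
    hc₂ (by linear_combination n₃)
    (by linear_combination m₃) (by linear_combination t₃) (by linear_combination p₃) q₇
  obtain ⟨a₈, q₉⟩ := completeQuotient_succ_linear (d' := w) (e' := e₂) hy hA hc₂
    hc₁ (by linear_combination n₂)
    (by linear_combination m₂) (by linear_combination t₂) (by linear_combination p₂) q₈
  obtain ⟨a₉, q₁₀⟩ := completeQuotient_succ_of_dvd hy hA hc₁ one_ne_zero n₁ (mul_one _) q₉
  obtain ⟨a₁₀, q₁₁⟩ := completeQuotient_succ_const hy hA hc₁ one_ne_zero (one_mul _) q₁₀
  have hk : (2 / 1 : K) ≠ 0 := div_ne_zero two_ne_zero one_ne_zero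
  refine hasCFPeriod_of_completeQuotient_eq (by norm_num) (q₁₁.trans q₁.symm) (fun h0 ↦ ?_)
    fun m hm hm' ↦ ?_
  · rw [partialQuotient, h0, polyPart_zero] at a₁₀
    exact C_mul_linear_ne_C_mul_quadratic hk 0 0 u (by rw [← a₁₀]; simp)
  · rw [a₁₀]
    interval_cases m
    all_goals simp only [a₁, a₂, a₃, a₄, a₅, a₆, a₇, a₈, a₉]
    all_goals exact C_mul_linear_ne_C_mul_quadratic hk _ _ _

/-- The family attached to points of order `6`: quasi-period `5`, twisted by the factor `4 * t`. -/
theorem hasCFPeriod_ten_of_order_six [CharZero K] {t : K} (ht : t ≠ 0) (ht1 : t + 1 ≠ 0)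
    (ht4 : 4 * t ≠ 1) {y : LaurentSeries K}
    (hy : y ^ 2 = ofPoly (quartic ((3 * t ^ 2 + 6 * t - 1) / 4) (t * (t + 1)) ((t - 1) / 2)))
    (hA : 0 < (y - ofPoly (X ^ 2 + C ((3 * t ^ 2 + 6 * t - 1) / 4))).orderTop) :
    HasCFPeriod y 10 := by
  have h4 : (4 : K) ≠ 0 := by norm_num
  have hv : 4 * (t * (t + 1)) ≠ 0 := mul_ne_zero h4 (mul_ne_zero ht ht1)
  have hv' : -(4 * (t * (t + 1))) ≠ 0 := neg_ne_zero.mpr hv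
  have h4t : 4 * t ≠ 0 := mul_ne_zero h4 ht
  have h4t' : -(4 * t) ≠ 0 := neg_ne_zero.mpr h4t
  have ht1' : -(t + 1) ≠ 0 := neg_ne_zero.mpr ht1
  have q₁ := completeQuotient_one hv hy hA
  obtain ⟨a₁, q₂⟩ := completeQuotient_succ_linear (c' := -1) (d' := -(t + 1) / 2)
    (e' := -(t * (t + 1))) hy hA hv' (by norm_num)
    (by ring) (by ring) (by ring) (by ring) q₁
  obtain ⟨a₂, q₃⟩ := completeQuotient_succ_linear (c' := -(4 * t)) (d' := -(t + 1) / 2)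
    (e' := -t) hy hA (by norm_num) h4t' (by ring) (by ring) (by ring) (by ring) q₂
  obtain ⟨a₃, q₄⟩ := completeQuotient_succ_linear (c' := -(t + 1)) (d' := (t - 1) / 2)
    (e' := -(t * (t + 1))) hy hA h4t' ht1' (by ring) (by ring) (by ring) (by ring) q₃
  -- The constant 4t solves -(t + 1)·k = -4v. Because of it α₆ is 4t·α₁ rather than α₁; the
  -- following quotients are those of the first half alternately divided and multiplied by 4t.
  obtain ⟨a₄, q₅⟩ := completeQuotient_succ_of_dvd hy hA ht1' h4t (by ring) (by ring) q₄
  obtain ⟨a₅, q₆⟩ := completeQuotient_succ_const hy hA ht1' h4t (by ring) q₅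
  obtain ⟨a₆, q₇⟩ := completeQuotient_succ_linear (c' := -(4 * t)) (d' := -(t + 1) / 2)
    (e' := -(t * (t + 1))) hy hA ht1' h4t' (by ring) (by ring) (by ring) (by ring) q₆
  obtain ⟨a₇, q₈⟩ := completeQuotient_succ_linear (c' := -1) (d' := -(t + 1) / 2)
    (e' := -t) hy hA h4t' (by norm_num) (by ring) (by ring) (by ring) (by ring) q₇
  obtain ⟨a₈, q₉⟩ := completeQuotient_succ_linear (c' := -(4 * (t * (t + 1))))
    (d' := (t - 1) / 2) (e' := -(t * (t + 1))) hy hA (by norm_num) hv'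
    (by ring) (by ring) (by ring) (by ring) q₈
  obtain ⟨a₉, q₁₀⟩ := completeQuotient_succ_of_dvd hy hA hv' one_ne_zero (by ring) (by ring) q₉
  obtain ⟨a₁₀, q₁₁⟩ := completeQuotient_succ_const hy hA hv' one_ne_zero (by ring) q₁₀
  have hk : (2 / 1 : K) ≠ 0 := div_ne_zero two_ne_zero one_ne_zero
  refine hasCFPeriod_of_completeQuotient_eq (by norm_num) (q₁₁.trans q₁.symm) (fun h0 ↦ ?_)
    fun m hm hm' ↦ ?_
  · rw [partialQuotient, h0, polyPart_zero] at a₁₀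
    exact C_mul_linear_ne_C_mul_quadratic hk 0 0 _ (by rw [← a₁₀]; simp)
  · rw [a₁₀]
    rcases eq_or_ne m 5 with rfl | hm5
    · rw [a₅]
      intro h
      -- Comparing x² coefficients gives 2/(4t) = 2.
      have h2 := congrArg (fun p ↦ p.coeff 2) h
      simp [coeff_X_pow] at h2
      field_simp at h2
      exact ht4 (by linear_combination -h2)
    · interval_cases m
      all_goals first | exact absurd rfl hm5 | simp only [a₁, a₂, a₃, a₄, a₆, a₇, a₈, a₉]
      all_goals exact C_mul_linear_ne_C_mul_quadratic hk _ _ _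

/-- The family attached to points of order `11`, parametrised by the modular curve `X₁(11)`. -/
theorem hasCFPeriod_ten_of_order_eleven [CharZero K] {s t : K} (ht : t ≠ 0) (hs : s ≠ 0)
    (hs1 : s - 1 ≠ 0) (hst : s - t ≠ 0) (hC : s ^ 2 - s = t ^ 3 - t ^ 2) {u v w : K}
    (hu : u = -((s ^ 4 + 2 * s ^ 3 * t + t ^ 2 + 6 * s * t ^ 2 - 3 * s ^ 2 * t * (2 + t))
      / (4 * t ^ 2)))
    (hv : v = -(((-1 + s) * s * (s - t)) / t)) (hw : w = (s ^ 2 - t - s * t) / (2 * t))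
    {y : LaurentSeries K}
    (hy : y ^ 2 = ofPoly (quartic u v w)) (hA : 0 < (y - ofPoly (X ^ 2 + C u)).orderTop) :
    HasCFPeriod y 10 := by
  have hs1' : -1 + s ≠ 0 := by rwa [neg_add_eq_sub]
  have h4 : (4 : K) ≠ 0 := by norm_num
  -- The closing relation at the centre is the only one that needs the equation of X₁(11); the
  -- others are identities in s and t.
  have n₅ : s * (s - 1) * (s - t) / t ^ 2 + s * (s - 1) * (s - t) / t ^ 2 +
      ((s ^ 2 + s * t + t - 2 * s - 2 * t ^ 2) / (2 * t)) ^ 2 + u = 0 := by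
    have : s * (s - 1) * (s - t) / t ^ 2 + s * (s - 1) * (s - t) / t ^ 2 +
        ((s ^ 2 + s * t + t - 2 * s - 2 * t ^ 2) / (2 * t)) ^ 2 + u
        = (s - t) / t ^ 2 * ((s ^ 2 - s) - (t ^ 3 - t ^ 2)) := by
      rw [hu]; field_simp; ring
    rw [this, hC, sub_self, mul_zero]
  refine hasCFPeriod_ten_of_palindrome hy hA (e₂ := s * (s - 1) * (s - t) / t)
    (e₃ := -(s * (s - t) / t)) (e₄ := -(s * (s - 1))) (e₅ := s * (s - 1) * (s - t) / t ^ 2)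
    (w₂ := -((s ^ 2 + t - s * t) / (2 * t))) (w₃ := (s ^ 2 + s * t - t) / (2 * t))
    (w₄ := (2 * s - t - s ^ 2 - s * t) / (2 * t))
    (w₅ := (s ^ 2 + s * t + t - 2 * s - 2 * t ^ 2) / (2 * t))
    (c₂ := -1) (c₃ := -(4 * (s * (s - t) / t))) (c₄ := -(t * (s - 1) / (s - t)))
    (c₅ := 4 * (s * (s - t) ^ 2 / t ^ 3))
    ?_ ?_ ?_ ?_ ?_ ?_ ?_ ?_ ?_ n₅ ?_ ?_ ?_ ?_ ?_ ?_ ?_ ?_ ?_ ?_ ?_ ?_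
  · rw [hv]
    exact neg_ne_zero.mpr (div_ne_zero (mul_ne_zero (mul_ne_zero hs1' hs) hst) ht)
  · norm_num
  · exact neg_ne_zero.mpr (mul_ne_zero h4 (div_ne_zero (mul_ne_zero hs hst) ht))
  · exact neg_ne_zero.mpr (div_ne_zero (mul_ne_zero ht hs1) hst)
  · exact mul_ne_zero h4 (div_ne_zero (mul_ne_zero hs (pow_ne_zero 2 hst)) (pow_ne_zero 3 ht))
  all_goals
    subst hu hv hw
    field_simp <;> ring

end FunctionFieldCF

theorem mainTheorem7 {K : Type*} [Field K] [NumberField K] (hK : Module.finrank ℚ K = 2) :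
    (∀ t : K, t * (t + 1) * (3 * t ^ 2 + 6 * t - 1) ≠ 0 → 4 * t ≠ 1 →
      FunctionFieldCF.SqrtHasCFPeriod
        (FunctionFieldCF.quartic
          ((3 * t ^ 2 + 6 * t - 1) / 4)
          (t * (t + 1))
          ((t - 1) / 2)) 10) ∧
    (∀ s t : K, s ^ 2 - s = t ^ 3 - t ^ 2 →
      t * (t - 1) * (t ^ 5 - 18 * t ^ 4 + 35 * t ^ 3 - 16 * t ^ 2 - 2 * t + 1) ≠ 0 →
      FunctionFieldCF.SqrtHasCFPeriod
        (FunctionFieldCF.quartic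
          (-((s ^ 4 + 2 * s ^ 3 * t + t ^ 2 + 6 * s * t ^ 2 - 3 * s ^ 2 * t * (2 + t))
              / (4 * t ^ 2)))
          (-(((-1 + s) * s * (s - t)) / t))
          ((s ^ 2 - t - s * t) / (2 * t))) 10) := by
  refine ⟨fun t ht ht4 ↦ ?_, fun s t hC ht ↦ ?_⟩
  · have h := left_ne_zero_of_mul ht
    exact FunctionFieldCF.sqrtHasCFPeriod_of_forall fun y hy hA ↦
      FunctionFieldCF.hasCFPeriod_ten_of_order_six (left_ne_zero_of_mul h)
        (right_ne_zero_of_mul h) ht4 hy hA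
  · have h := left_ne_zero_of_mul ht
    have ht0 := left_ne_zero_of_mul h
    have ht1 := right_ne_zero_of_mul h
    have hss : s * (s - 1) ≠ 0 := by
      rw [show s * (s - 1) = t ^ 2 * (t - 1) by linear_combination hC]
      exact mul_ne_zero (pow_ne_zero 2 ht0) ht1
    have hst : s - t ≠ 0 := fun h0 ↦ by
      obtain rfl := sub_eq_zero.mp h0
      -- On the curve, s = t forces t(t - 1)² = 0.
      exact mul_ne_zero ht0 (pow_ne_zero 2 ht1) (by linear_combination -hC)
    exact FunctionFieldCF.sqrtHasCFPeriod_of_forall fun y hy hA ↦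
      FunctionFieldCF.hasCFPeriod_ten_of_order_eleven ht0 (left_ne_zero_of_mul hss)
        (right_ne_zero_of_mul hss) hst hC rfl rfl rfl hy hA
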